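/- Let $d \ge 2$ and let $\Sigma$ be an alphabet with $d$ letters. Let $\mathcal{T}_d$ be the $d$-regular rooted tree, whose vertices are the words in $\Sigma^\star$, with root the empty word and with $va$ ($a\in\Sigma$) the children of $v$; let $\mathrm{Aut}(\mathcal{T}_d)$ be its group of graph automorphisms. For $\alpha\in\mathrm{Aut}(\mathcal{T}_d)$ and a vertex $v$, the restriction $\alpha|_v\in\mathrm{Aut}(\mathcal{T}_d)$ is defined by $\alpha(vu)=\alpha(v)\,\alpha|_v(u)$ for all $u\in\Sigma^\star$. An automorphism $\alpha$ is - an automaton automorphism if there is a finite directed graph with an initial vertex and with edges labelled by $\Sigma\times\Sigma$, such that each vertex has exactly $d$ outgoing edges, exactly one with label of the form $(a,\cdot)$ and exactly one with label of the form $(\cdot,a)$ for each $a\in\Sigma$, and such that $\alpha(b_1\cdots b_k)=b_1'\cdots b_k'$ whenever $(b_1,b_1')\cdots(b_k,b_k')$ labels a path from the initial vertex; - bounded if there is $N\in\mathbb{N}$ such that for each $k\in\mathbb{N}$ at most $N$ vertices $v$ with $|v|=k$ satisfy $\alpha|_v\neq 1$. A bounded automata group is a subgroup of $\mathrm{Aut}(\mathcal{T}_d)$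 all of whose elements are bounded automaton automorphisms. An ET0L grammar consists of a finite set $A$ of terminals, a finite set $V$ of non-terminals disjoint from $A$, a start symbol $S\in V$, finitely many tables, and a regular language $\mathcal{R}$ of finite sequences of tables. Here a table $\tau$ is a finite set of rules $X\to w$ with $X\in V$ and $w\in(A\cup V)^\star$ containing at least one rule for each $X\in V$, and $w\to^\tau w'$ means that $w'$ is obtained from $w$ by replacing simultaneously each occurrence of a non-terminal by means of some rule of $\tau$, chosen independently for each occurrence. The language of the grammar is the set of all $w\in A^\star$ for which there is $\tau_1\tau_2\cdots\tau_k\in\mathcal{R}$ with $S\to^{\tau_1}w_1\to^{\tau_2}\cdots\to^{\tau_k}w$. An ET0L language is the language of an ET0L grammar. For a group $G$ and a finite generating set $X$ of $G$, the co-word problem $\mathrm{coW}(G,X)$ is the set of all words in $(X\cup X^{-1})^\star$ that represent non-trivial elements of $G$. **Theorem.** Every finitely generated bounded automata group $G$ is co-ET0L: for every finite generating set $X$ of $G$, the language $\mathrm{coW}(G,X)$ is ET0L. -/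

import Mathlib

open scoped Pointwise

/-! ## The regular rooted tree and its automorphisms -/

/-- The `d`-regular rooted tree. Vertices are words over `Fin d`, the root is the empty word, and
the children of `v` are the words `v ++ [a]`. -/
def RegularTree (d : ℕ) : SimpleGraph (List (Fin d)) where
  Adj u v := (∃ a, v = u ++ [a]) ∨ (∃ a, u = v ++ [a])
  symm := ⟨fun _ _ h => h.symm⟩
  loopless := ⟨fun u h => by
    rcases h with ⟨a, h⟩ | ⟨a, h⟩ <;> simp at h⟩

/-- `Aut(T_d)`: the graph automorphisms of the tree, a group under composition. -/
abbrev TreeAut (d : ℕ) : Type := RegularTree d ≃g RegularTree d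

namespace TreeAut

variable {d : ℕ}

theorem neighborSet_nil : (RegularTree d).neighborSet [] = Set.range (fun a : Fin d => [a]) := by
  ext v
  simp only [SimpleGraph.mem_neighborSet, RegularTree, Set.mem_range]
  constructor
  · rintro (⟨a, h⟩ | ⟨a, h⟩)
    · exact ⟨a, h.symm⟩
    · simp at h
  · rintro ⟨a, h⟩
    exact Or.inl ⟨a, h.symm⟩

theorem neighborSet_concat (u : List (Fin d)) (b : Fin d) :
    (RegularTree d).neighborSet (u ++ [b]) =
      insert u (Set.range (fun a : Fin d => u ++ [b] ++ [a])) := by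
  ext v
  simp only [SimpleGraph.mem_neighborSet, RegularTree, Set.mem_insert_iff, Set.mem_range]
  constructor
  · rintro (⟨a, h⟩ | ⟨a, h⟩)
    · exact Or.inr ⟨a, h.symm⟩
    · exact Or.inl (List.append_inj_left' h rfl).symm
  · rintro (h | ⟨a, h⟩)
    · exact Or.inr ⟨b, by rw [h]⟩
    · exact Or.inl ⟨a, h.symm⟩

/-- Automorphisms fix the root. -/
theorem apply_nil (α : TreeAut d) : α [] = [] := by
  by_contra hne
  obtain ⟨u, b, hub⟩ : ∃ u b, α [] = u ++ [b] :=
    ⟨_, _, (List.dropLast_append_getLast hne).symm⟩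
  have h1 : Nat.card ((RegularTree d).neighborSet []) = d := by
    rw [neighborSet_nil, Nat.card_range_of_injective (by intro a b h; simpa using h)]
    simp
  have h2 : Nat.card ((RegularTree d).neighborSet (u ++ [b])) = d + 1 := by
    rw [neighborSet_concat, Nat.card_coe_set_eq, Set.ncard_insert_of_notMem _ (Set.finite_range _),
      ← Nat.card_coe_set_eq, Nat.card_range_of_injective (by intro a b h; simpa using h)]
    · simp
    · rintro ⟨a, h⟩
      have := congrArg List.length h
      simp at this
  have h3 := Nat.card_congr (SimpleGraph.Iso.mapNeighborSet α [])
  rw [hub, h1, h2] at h3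
  omega

/-- Automorphisms send children of a vertex to children of its image. -/
theorem exists_apply_concat (α : TreeAut d) (w : List (Fin d)) :
    ∀ a, ∃ b, α (w ++ [a]) = α w ++ [b] := by
  induction w using List.reverseRecOn with
  | nil =>
    intro a
    have h : (RegularTree d).Adj (α []) (α ([] ++ [a])) := α.map_rel_iff.2 (Or.inl ⟨a, rfl⟩)
    rcases h with ⟨b, h⟩ | ⟨b, h⟩
    · exact ⟨b, h⟩
    · rw [apply_nil] at h
      simp at h
  | append_singleton w' c ih =>
    intro a
    have h : (RegularTree d).Adj (α (w' ++ [c])) (α (w' ++ [c] ++ [a])) :=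
      α.map_rel_iff.2 (Or.inl ⟨a, rfl⟩)
    rcases h with ⟨b, h⟩ | ⟨b, h⟩
    · exact ⟨b, h⟩
    · obtain ⟨b', hb'⟩ := ih c
      rw [hb'] at h
      have h' := α.injective (List.append_inj_left' h rfl)
      have := congrArg List.length h'
      simp at this

/-- Automorphisms preserve levels. -/
theorem length_apply (α : TreeAut d) (w : List (Fin d)) : (α w).length = w.length := by
  induction w using List.reverseRecOn with
  | nil => rw [apply_nil]
  | append_singleton w a ih =>
    obtain ⟨b, hb⟩ := exists_apply_concat α w a
    simp [hb, ih]

theorem prefix_apply_append (α : TreeAut d) (w u : List (Fin d)) : α w <+: α (w ++ u) := by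
  induction u using List.reverseRecOn with
  | nil => simp
  | append_singleton u a ih =>
    obtain ⟨b, hb⟩ := exists_apply_concat α (w ++ u) a
    rw [← List.append_assoc, hb]
    exact ih.trans (List.prefix_append _ _)

theorem apply_append_drop (α : TreeAut d) (w u : List (Fin d)) :
    α w ++ (α (w ++ u)).drop w.length = α (w ++ u) := by
  obtain ⟨t, ht⟩ := prefix_apply_append α w u
  rw [← ht, ← length_apply α w, List.drop_left]

theorem adj_append_left (w x y : List (Fin d)) :
    (RegularTree d).Adj (w ++ x) (w ++ y) ↔ (RegularTree d).Adj x y := by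
  simp [RegularTree]

/-- The restriction `α|_w`, the action of `α` on the subtree with root `w`: it is determined by
`α (w ++ u) = α w ++ α|_w u`. -/
def restrict (α : TreeAut d) (w : List (Fin d)) : TreeAut d where
  toFun u := (α (w ++ u)).drop w.length
  invFun u := (α.symm (α w ++ u)).drop w.length
  left_inv u := by
    change (α.symm (α w ++ (α (w ++ u)).drop w.length)).drop w.length = u
    rw [apply_append_drop, RelIso.symm_apply_apply, List.drop_left]
  right_inv u := by
    change (α (w ++ (α.symm (α w ++ u)).drop w.length)).drop w.length = u
    have h := apply_append_drop α.symm (α w) u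
    rw [RelIso.symm_apply_apply, length_apply] at h
    rw [h, RelIso.apply_symm_apply, ← length_apply α w, List.drop_left]
  map_rel_iff' {x y} := by
    change (RegularTree d).Adj ((α (w ++ x)).drop w.length) ((α (w ++ y)).drop w.length) ↔ _
    rw [← adj_append_left (α w), apply_append_drop, apply_append_drop,
      ← adj_append_left w x y]
    exact α.map_rel_iff

theorem apply_append (α : TreeAut d) (w u : List (Fin d)) :
    α (w ++ u) = α w ++ α.restrict w u :=
  (apply_append_drop α w u).symm

end TreeAut

/-! ## Bounded automata groups -/

/-- An automaton over the alphabet `A` with an initial state: a finite directed graph in which every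
vertex `s` has, for each letter `a`, exactly one outgoing edge labelled `(a, ·)`, namely the edge to
`next s a` with label `(a, output s a)`, and exactly one labelled `(·, a)`, that is, `output s` is a
permutation of `A`. -/
structure SigmaAutomaton (A : Type) where
  State : Type
  [finite_state : Finite State]
  output : State → Equiv.Perm A
  next : State → A → State
  init : State

/-- The word of second labels along the path from `s` whose first labels spell the given word. -/
def SigmaAutomaton.run {A : Type} (M : SigmaAutomaton A) : M.State → List A → List A
  | _, [] => []
  | s, a :: w => M.output s a :: M.run (M.next s a) w

/-- `α` is an automaton automorphism: it is induced by some finite automaton. -/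
def TreeAut.IsAutomaton {d : ℕ} (α : TreeAut d) : Prop :=
  ∃ M : SigmaAutomaton (Fin d), ∀ w, α w = M.run M.init w

/-- `α` is bounded: some `N` bounds, on every level, the number of vertices on which the restriction
of `α` is nontrivial. -/
def TreeAut.IsBounded {d : ℕ} (α : TreeAut d) : Prop :=
  ∃ N : ℕ, ∀ k : ℕ, {v : List (Fin d) | v.length = k ∧ α.restrict v ≠ 1}.encard ≤ N

/-- A bounded automata group is a subgroup of `Aut(T_d)` all of whose elements are bounded automaton
automorphisms. -/
def IsBoundedAutomataGroup {d : ℕ} (G : Subgroup (TreeAut d)) : Prop :=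
  ∀ α ∈ G, TreeAut.IsAutomaton α ∧ TreeAut.IsBounded α

/-! ## ET0L languages -/

/-- A table: a finite set of context-free rules `X → w` in which every nonterminal has at least one
replacement. `Symbol T N` is the disjoint union of the terminals `T` and the nonterminals `N`. -/
structure ET0LTable (T N : Type*) where
  rules : Set (N × List (Symbol T N))
  finite_rules : rules.Finite
  total : ∀ X : N, ∃ w, (X, w) ∈ rules

/-- `τ.Step w w'`: the word `w'` arises from `w` by replacing simultaneously every occurrence of a
nonterminal by a rule of `τ`, chosen independently for each occurrence; terminals stay. -/
inductive ET0LTable.Step {T N : Type*} (τ : ET0LTable T N) :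
    List (Symbol T N) → List (Symbol T N) → Prop
  | nil : ET0LTable.Step τ [] []
  | terminal (a : T) {w w' : List (Symbol T N)} (h : ET0LTable.Step τ w w') :
      ET0LTable.Step τ (Symbol.terminal a :: w) (Symbol.terminal a :: w')
  | nonterminal (X : N) (u : List (Symbol T N)) (hu : (X, u) ∈ τ.rules)
      {w w' : List (Symbol T N)} (h : ET0LTable.Step τ w w') :
      ET0LTable.Step τ (Symbol.nonterminal X :: w) (u ++ w')

/-- An ET0L grammar with terminal alphabet `T`. The finitely many tables are indexed by
`TableName`, and the rational control is a regular language of sequences of tables. -/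
structure ET0LGrammar (T : Type*) where
  [finite_terminals : Finite T]
  NT : Type
  [finite_NT : Finite NT]
  TableName : Type
  [finite_tableName : Finite TableName]
  table : TableName → ET0LTable T NT
  control : Language TableName
  control_regular : control.IsRegular
  start : NT

namespace ET0LGrammar

variable {T : Type*}

/-- `w →^{v} w'`: applying the tables in the sequence `v`, from left to right, can turn `w` into
`w'`. -/
def Derives (g : ET0LGrammar T) :
    List g.TableName → List (Symbol T g.NT) → List (Symbol T g.NT) → Prop
  | [], w, w' => w = w'
  | t :: v, w, w' => ∃ w₁, (g.table t).Step w w₁ ∧ g.Derives v w₁ w'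

/-- The language generated by the grammar. -/
def language (g : ET0LGrammar T) : Language T :=
  {w | ∃ v ∈ g.control, g.Derives v [Symbol.nonterminal g.start] (w.map Symbol.terminal)}

end ET0LGrammar

/-- `L` is an ET0L language. -/
def IsET0L {T : Type*} (L : Language T) : Prop :=
  ∃ g : ET0LGrammar T, g.language = L

/-! ## Co-word problems -/

/-- The co-word problem `coW(G, X)`: all words over `X ∪ X⁻¹` representing a nontrivial element. -/
def coWordProblem {G : Type*} [Group G] (X : Set G) : Language ↥(X ∪ X⁻¹) :=
  {w | (w.map (fun x => (x : G))).prod ≠ 1}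

/-- `G` is co-ET0L: it is finitely generated and its co-word problem with respect to every finite
generating set is an ET0L language. -/
def IsCoET0L (G : Type*) [Group G] : Prop :=
  Group.FG G ∧ ∀ X : Set G, X.Finite → Subgroup.closure X = ⊤ → IsET0L (coWordProblem X)

/-! ## Restrictions of tree automorphisms -/

namespace TreeAut

variable {d : ℕ}

/-! On every level, a fixed word of bounded automorphisms meets nontrivial restrictions along the
orbits of at most `N` vertices. A moved vertex has `d ^ N > N` descendants `N` levels below, all of
them moved. Hence the word is nontrivial exactly when it carries some `p` to some `q ≠ p` with
trivial restrictions all the way (`prod_ne_one_iff_exists_carriesTo`).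

The grammar generates such words. On each level it marks the vertices on two rays, through `p` and
through `q`, the vertices where a generator has a nontrivial restriction, and the images of the
latter under that generator. These sets are uniformly bounded and closed under parents. For words
carrying one marked vertex to another, `CarriesTo.split` looks at the parents and cuts at the last
nontrivial restriction met there. After the cut the last letter of the vertex no longer changes, so
that factor carries a marked parent to a marked parent; the factor before the cut is shorter and of
the original kind. Tables therefore climb from the level of `p` to the root.

Generators have finitely many restrictions, so the rules need only finite data on marked vertices.
The data of children follow from those of parents (`levelData_extend`), so a finite automaton
working down from the root checks that the tables describe actual vertices. Soundness is
`mem_meaning_of_derives`, completeness `exists_tables`. -/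

theorem restrict_one (w : List (Fin d)) : (1 : TreeAut d).restrict w = 1 :=
  RelIso.ext fun u => List.drop_left (l₁ := w) (l₂ := u)

theorem restrict_append (α : TreeAut d) (v w : List (Fin d)) :
    α.restrict (v ++ w) = (α.restrict v).restrict w := by
  refine RelIso.ext fun u => ?_
  have h1 := apply_append α (v ++ w) u
  rw [List.append_assoc, apply_append α v, apply_append (α.restrict v) w, apply_append α v w,
    List.append_assoc] at h1
  exact (List.append_cancel_left (List.append_cancel_left h1)).symm

theorem restrict_append_eq_one {α : TreeAut d} {v : List (Fin d)} (h : α.restrict v = 1)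
    (w : List (Fin d)) : α.restrict (v ++ w) = 1 := by
  rw [restrict_append, h, restrict_one]

theorem apply_append_of_restrict_eq_one {α : TreeAut d} {v : List (Fin d)}
    (h : α.restrict v = 1) (w : List (Fin d)) : α (v ++ w) = α v ++ w := by
  rw [apply_append, h]; rfl

end TreeAut

/-- The state reached from `s` by the path whose first labels spell the given word. -/
def SigmaAutomaton.stateAfter {A : Type} (M : SigmaAutomaton A) : M.State → List A → M.State
  | s, [] => s
  | s, a :: w => M.stateAfter (M.next s a) w

theorem SigmaAutomaton.run_append {A : Type} (M : SigmaAutomaton A) (s : M.State) (v w : List A) :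
    M.run s (v ++ w) = M.run s v ++ M.run (M.stateAfter s v) w := by
  induction v generalizing s with
  | nil => rfl
  | cons a v ih => simp [SigmaAutomaton.run, SigmaAutomaton.stateAfter, ih]

/-- An automaton automorphism has finitely many restrictions. -/
theorem TreeAut.IsAutomaton.finite_range_restrict {d : ℕ} {α : TreeAut d} (h : α.IsAutomaton) :
    (Set.range α.restrict).Finite := by
  obtain ⟨M, hM⟩ := h
  have := M.finite_state
  have hr : ∀ v u, α.restrict v u = M.run (M.stateAfter M.init v) u := by
    intro v u
    have h1 := TreeAut.apply_append α v u
    rw [hM, hM, M.run_append] at h1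
    exact (List.append_cancel_left h1).symm
  classical
  -- The restriction at `v` depends only on the state reached by `v`; the value `1` at unreachable
  -- states is a dummy.
  refine (Set.finite_range fun s : M.State =>
    if h : ∃ v, M.stateAfter M.init v = s then α.restrict h.choose else 1).subset ?_
  rintro _ ⟨v, rfl⟩
  have hv : ∃ v', M.stateAfter M.init v' = M.stateAfter M.init v := ⟨v, rfl⟩
  refine ⟨M.stateAfter M.init v, ?_⟩
  simp only [dif_pos hv]
  refine RelIso.ext fun u => ?_
  rw [hr, hr, hv.choose_spec]

/-! ## Words acting with trivial restrictions -/

section CarriesTo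

variable {d : ℕ} {T : Type*}

/-- The word `w`, acting from its last letter to its first, carries `p` to `q`, and each letter
has trivial restriction at the vertex to which it is applied. -/
def CarriesTo (ρ : T → TreeAut d) : List T → List (Fin d) → List (Fin d) → Prop
  | [], p, q => p = q
  | y :: w, p, q => ∃ r, CarriesTo ρ w p r ∧ ρ y r = q ∧ (ρ y).restrict r = 1

variable {ρ : T → TreeAut d}

theorem CarriesTo.append {u w : List T} {p r q : List (Fin d)} (hu : CarriesTo ρ u r q)
    (hw : CarriesTo ρ w p r) : CarriesTo ρ (u ++ w) p q := by
  induction u generalizing q with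
  | nil => cases hu; exact hw
  | cons y u ih =>
    obtain ⟨s, hs, h⟩ := hu
    exact ⟨s, ih hs, h⟩

theorem CarriesTo.append_right {w : List T} {p q : List (Fin d)} (h : CarriesTo ρ w p q)
    (u : List (Fin d)) : CarriesTo ρ w (p ++ u) (q ++ u) := by
  induction w generalizing q with
  | nil => cases h; rfl
  | cons y w ih =>
    obtain ⟨r, hr, rfl, h1⟩ := h
    exact ⟨r ++ u, ih hr, TreeAut.apply_append_of_restrict_eq_one h1 u,
      TreeAut.restrict_append_eq_one h1 u⟩

theorem CarriesTo.prod_apply {w : List T} {p q : List (Fin d)} (h : CarriesTo ρ w p q) :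
    (w.map ρ).prod p = q := by
  induction w generalizing q with
  | nil => exact h
  | cons y w ih =>
    obtain ⟨r, hr, rfl, -⟩ := h
    simp [RelIso.mul_apply, ih hr]

theorem CarriesTo.length_eq {w : List T} {p q : List (Fin d)} (h : CarriesTo ρ w p q) :
    p.length = q.length := by
  rw [← h.prod_apply, TreeAut.length_apply]

/-! ### Counting orbits that meet nontrivial restrictions -/

/-- A word of bounded automorphisms has nontrivial restrictions along the orbits of boundedly many
vertices of each level. -/
theorem exists_encard_not_carriesTo_le (hb : ∀ y, (ρ y).IsBounded) (w : List T) :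
    ∃ N : ℕ, ∀ k : ℕ, {p : List (Fin d) |
      p.length = k ∧ ¬ CarriesTo ρ w p ((w.map ρ).prod p)}.encard ≤ N := by
  induction w with
  | nil => exact ⟨0, fun k => by simp [CarriesTo]⟩
  | cons y w ih =>
    obtain ⟨N, hN⟩ := ih
    obtain ⟨N', hN'⟩ := hb y
    refine ⟨N + N', fun k => ?_⟩
    set β := (w.map ρ).prod with hβ
    -- An exceptional vertex for `y :: w` is exceptional for `w`, or is sent by `w` to a vertex
    -- where `y` has a nontrivial restriction.
    have hsub : {p : List (Fin d) |
        p.length = k ∧ ¬ CarriesTo ρ (y :: w) p (((y :: w).map ρ).prod p)} ⊆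
        {p | p.length = k ∧ ¬ CarriesTo ρ w p (β p)} ∪
          β ⁻¹' {v | v.length = k ∧ (ρ y).restrict v ≠ 1} := by
      rintro p ⟨hp, h⟩
      by_contra hc
      simp only [Set.mem_union, Set.mem_ofPred_eq, Set.mem_preimage, TreeAut.length_apply, hp,
        true_and, not_or, not_not] at hc
      exact h ⟨β p, hc.1, by simp [RelIso.mul_apply, hβ], hc.2⟩
    calc _ ≤ _ := Set.encard_le_encard hsub
      _ ≤ _ := Set.encard_union_le _ _
      _ ≤ (N : ℕ∞) + N' := by
        refine add_le_add (hN k) (le_trans ?_ (hN' k))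
        exact (β.injective.encard_image _).ge.trans
          (Set.encard_le_encard (Set.image_preimage_subset _ _))
      _ = _ := by simp

/-- Over an alphabet with at least two letters, a word of bounded automorphisms represents a
nontrivial automorphism if and only if it moves some vertex with trivial restrictions on the way. -/
theorem prod_ne_one_iff_exists_carriesTo (hd : 2 ≤ d) (hb : ∀ y, (ρ y).IsBounded) (w : List T) :
    (w.map ρ).prod ≠ 1 ↔ ∃ p q, p ≠ q ∧ CarriesTo ρ w p q := by
  set β := (w.map ρ).prod with hβ
  constructor
  · intro h
    obtain ⟨v, hv⟩ : ∃ v, β v ≠ v := by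
      by_contra! hc
      exact h (RelIso.ext hc)
    obtain ⟨N, hN⟩ := exists_encard_not_carriesTo_le hb w
    by_contra! hc
    have hinj : Function.Injective fun f : Fin N → Fin d => v ++ List.ofFn f :=
      fun f g hfg => List.ofFn_injective (List.append_cancel_left hfg)
    -- All `d ^ N` descendants of the moved vertex `v` at this depth are moved, so under `hc` all
    -- are exceptional.
    have hsub : Set.range (fun f : Fin N → Fin d => v ++ List.ofFn f) ⊆
        {p | p.length = v.length + N ∧ ¬ CarriesTo ρ w p (β p)} := by
      rintro _ ⟨f, rfl⟩
      refine ⟨by simp, hc _ _ fun he => hv ?_⟩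
      rw [TreeAut.apply_append] at he
      exact (List.append_inj_left he (TreeAut.length_apply β v).symm).symm
    have h1 := (Set.encard_le_encard hsub).trans (hN _)
    rw [← Set.image_univ, hinj.encard_image, Set.encard_univ, ENat.card_eq_coe_natCard] at h1
    have h2 : d ^ N ≤ N := by
      simp only [Nat.card_eq_fintype_card, Fintype.card_fun, Fintype.card_fin] at h1
      exact_mod_cast h1
    exact absurd h2 (not_le.2 ((Nat.lt_two_pow_self).trans_le (Nat.pow_le_pow_left hd N)))
  · rintro ⟨p, q, hpq, h⟩ h1
    have h2 := h.prod_apply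
    rw [← hβ, h1] at h2
    exact hpq h2

/-- Last time that a trajectory on the children of a level meets a nontrivial restriction. -/
theorem CarriesTo.split {w : List T} {p q : List (Fin d)} {a b : Fin d}
    (h : CarriesTo ρ w (p ++ [a]) (q ++ [b])) :
    (CarriesTo ρ w p q ∧ a = b) ∨
      ∃ w₁ y w₂ r c, w = w₁ ++ y :: w₂ ∧ (ρ y).restrict r ≠ 1 ∧
        CarriesTo ρ w₂ (p ++ [a]) (r ++ [c]) ∧ (ρ y).restrict r [c] = [b] ∧
        (ρ y).restrict (r ++ [c]) = 1 ∧ CarriesTo ρ w₁ (ρ y r) q := by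
  induction w generalizing q b with
  | nil =>
    have := List.append_inj' (show p ++ [a] = q ++ [b] from h) rfl
    exact Or.inl ⟨this.1, by simpa using this.2⟩
  | cons y w ih =>
    obtain ⟨s, hs, hys, h1⟩ := h
    have hne : s ≠ [] := by
      rintro rfl
      simpa using hs.length_eq
    obtain ⟨r, c, rfl⟩ : ∃ r c, s = r ++ [c] := ⟨_, _, (List.dropLast_append_getLast hne).symm⟩
    rw [TreeAut.apply_append] at hys
    obtain ⟨hq, hcb⟩ := List.append_inj' hys (by rw [TreeAut.length_apply]; rfl)
    -- The letter `y` acts last: if its restriction at `r` is nontrivial, the cut is here; otherwise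
    -- it keeps the last letter and joins the factor after the cut.
    by_cases hr : (ρ y).restrict r = 1
    · have hcb' : c = b := by simpa [hr] using hcb
      subst hcb'
      rcases ih hs with ⟨h2, h3⟩ | ⟨w₁, y', w₂, r', c', h2, h3, h4, h5, h6, h7⟩
      · exact Or.inl ⟨⟨r, h2, hq, hr⟩, h3⟩
      · exact Or.inr ⟨y :: w₁, y', w₂, r', c', by simp [h2], h3, h4, h5, h6, r, h7, hq, hr⟩
    · exact Or.inr ⟨[], y, w, r, c, rfl, hr, hs, hcb, h1, hq⟩

end CarriesTo

/-! ## Derivations in ET0L grammars -/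

namespace ET0LTable

variable {T N : Type*} {τ : ET0LTable T N}

theorem Step.append {u₁ v₁ u₂ v₂ : List (Symbol T N)} (h₁ : τ.Step u₁ v₁) (h₂ : τ.Step u₂ v₂) :
    τ.Step (u₁ ++ u₂) (v₁ ++ v₂) := by
  induction h₁ with
  | nil => exact h₂
  | terminal a _ ih => exact .terminal a ih
  | nonterminal X u hu _ ih =>
    rw [List.append_assoc]
    exact .nonterminal X u hu ih

theorem step_map_terminal (w : List T) :
    τ.Step (w.map Symbol.terminal) (w.map Symbol.terminal) := by
  induction w with
  | nil => exact .nil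
  | cons a w ih => exact .terminal a ih

theorem step_of_mem {X : N} {u : List (Symbol T N)} (h : (X, u) ∈ τ.rules) :
    τ.Step [Symbol.nonterminal X] u := by
  simpa using Step.nonterminal X u h .nil

/-- The set of words obtained from a sentential form when `L X` is substituted for `X`. -/
def sentenceLanguage (L : N → Language T) (u : List (Symbol T N)) : Language T :=
  (u.map fun s => match s with
    | .terminal a => ({[a]} : Language T)
    | .nonterminal X => L X).prod

theorem sentenceLanguage_append (L : N → Language T) (u v : List (Symbol T N)) :
    sentenceLanguage L (u ++ v) = sentenceLanguage L u * sentenceLanguage L v := by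
  simp [sentenceLanguage]

theorem mem_sentenceLanguage_nil {L : N → Language T} {w : List T} :
    w ∈ sentenceLanguage L [] ↔ w = [] := by
  simp [sentenceLanguage, Language.mem_one]

theorem mem_sentenceLanguage_terminal_cons {L : N → Language T} {a : T} {u : List (Symbol T N)}
    {w : List T} : w ∈ sentenceLanguage L (.terminal a :: u) ↔
      ∃ w', w' ∈ sentenceLanguage L u ∧ w = a :: w' := by
  simp only [sentenceLanguage, List.map_cons, List.prod_cons, Language.mem_mul]
  constructor
  · rintro ⟨_, rfl, w', hw', rfl⟩
    exact ⟨w', hw', rfl⟩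
  · rintro ⟨w', hw', rfl⟩
    exact ⟨[a], rfl, w', hw', rfl⟩

theorem mem_sentenceLanguage_nonterminal_cons {L : N → Language T} {X : N}
    {u : List (Symbol T N)} {w : List T} : w ∈ sentenceLanguage L (.nonterminal X :: u) ↔
      ∃ w₁ ∈ L X, ∃ w₂ ∈ sentenceLanguage L u, w₁ ++ w₂ = w := by
  simp only [sentenceLanguage, List.map_cons, List.prod_cons, Language.mem_mul]

theorem mem_sentenceLanguage_nonterminal {L : N → Language T} {X : N} {w : List T} :
    w ∈ sentenceLanguage L [.nonterminal X] ↔ w ∈ L X := by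
  simp [sentenceLanguage]

theorem mem_sentenceLanguage_map_terminal (L : N → Language T) (w : List T) :
    w ∈ sentenceLanguage L (w.map Symbol.terminal) := by
  induction w with
  | nil => exact mem_sentenceLanguage_nil.2 rfl
  | cons a w ih => exact mem_sentenceLanguage_terminal_cons.2 ⟨w, ih, rfl⟩

/-- If every rule of a table is sound, then so is every step. -/
theorem Step.sentenceLanguage_subset {L L' : N → Language T}
    (hτ : ∀ X u, (X, u) ∈ τ.rules → ∀ w ∈ sentenceLanguage L u, w ∈ L' X)
    {u v : List (Symbol T N)} (h : τ.Step u v) :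
    ∀ w ∈ sentenceLanguage L v, w ∈ sentenceLanguage L' u := by
  induction h with
  | nil => exact fun w hw => mem_sentenceLanguage_nil.2 (mem_sentenceLanguage_nil.1 hw)
  | terminal a _ ih =>
    intro w hw
    obtain ⟨w', hw', rfl⟩ := mem_sentenceLanguage_terminal_cons.1 hw
    exact mem_sentenceLanguage_terminal_cons.2 ⟨w', ih _ hw', rfl⟩
  | nonterminal X u hu _ ih =>
    intro w hw
    rw [sentenceLanguage_append] at hw
    obtain ⟨w₁, h₁, w₂, h₂, rfl⟩ := hw
    exact mem_sentenceLanguage_nonterminal_cons.2 ⟨w₁, hτ X u hu w₁ h₁, w₂, ih _ h₂, rfl⟩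

end ET0LTable

namespace ET0LGrammar

variable {T : Type*} {g : ET0LGrammar T}

/-- The table sequence `v` turns the sentential form `u` into the word `w` of terminals. -/
def Generates (g : ET0LGrammar T) (v : List g.TableName) (u : List (Symbol T g.NT))
    (w : List T) : Prop :=
  g.Derives v u (w.map Symbol.terminal)

theorem Derives.append {v : List g.TableName} {u₁ w₁ u₂ w₂ : List (Symbol T g.NT)}
    (h₁ : g.Derives v u₁ w₁) (h₂ : g.Derives v u₂ w₂) :
    g.Derives v (u₁ ++ u₂) (w₁ ++ w₂) := by
  induction v generalizing u₁ u₂ with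
  | nil => cases h₁; cases h₂; rfl
  | cons t v ih =>
    obtain ⟨x₁, hs₁, hx₁⟩ := h₁
    obtain ⟨x₂, hs₂, hx₂⟩ := h₂
    exact ⟨x₁ ++ x₂, hs₁.append hs₂, ih hx₁ hx₂⟩

theorem Generates.append {v : List g.TableName} {u₁ u₂ : List (Symbol T g.NT)} {w₁ w₂ : List T}
    (h₁ : g.Generates v u₁ w₁) (h₂ : g.Generates v u₂ w₂) :
    g.Generates v (u₁ ++ u₂) (w₁ ++ w₂) := by
  unfold Generates
  rw [List.map_append]
  exact Derives.append h₁ h₂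

theorem generates_map_terminal (v : List g.TableName) (w : List T) :
    g.Generates v (w.map Symbol.terminal) w := by
  induction v with
  | nil => rfl
  | cons t v ih => exact ⟨_, ET0LTable.step_map_terminal w, ih⟩

theorem Generates.terminal_cons {v : List g.TableName} {u : List (Symbol T g.NT)} {w : List T}
    (a : T) (h : g.Generates v u w) : g.Generates v (.terminal a :: u) (a :: w) :=
  (generates_map_terminal v [a]).append h

theorem Generates.of_rule {t : g.TableName} {v : List g.TableName} {X : g.NT}
    {u : List (Symbol T g.NT)} {w : List T} (hX : (X, u) ∈ (g.table t).rules)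
    (h : g.Generates v u w) : g.Generates (t :: v) [.nonterminal X] w :=
  ⟨u, ET0LTable.step_of_mem hX, h⟩

theorem Generates.replicate {t : g.TableName} {v : List g.TableName} {X : g.NT}
    {w : List T} (hX : (X, [.nonterminal X]) ∈ (g.table t).rules)
    (h : g.Generates v [.nonterminal X] w) (n : ℕ) :
    g.Generates (List.replicate n t ++ v) [.nonterminal X] w := by
  induction n with
  | zero => exact h
  | succ n ih => exact .of_rule hX ih

end ET0LGrammar

/-! ## A grammar for the words representing nontrivial automorphisms -/

namespace OrbitGrammar

variable {d : ℕ} {T : Type}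

/-- All restrictions of the automorphisms in a family. -/
def restrictions (ρ : T → TreeAut d) : Set (TreeAut d) :=
  ⋃ y, Set.range (ρ y).restrict

theorem restrict_mem_restrictions {ρ : T → TreeAut d} {β : TreeAut d}
    (h : β ∈ restrictions ρ) (v : List (Fin d)) : β.restrict v ∈ restrictions ρ := by
  obtain ⟨y, u, rfl⟩ := Set.mem_iUnion.1 h
  exact Set.mem_iUnion.2 ⟨y, u ++ v, TreeAut.restrict_append _ _ _⟩

/-! ### Finite data of marked vertices -/

/-- The action of a family of automorphisms on `M` marked vertices of a level: the restrictions
there, the images that are marked, and the coincidences between marked vertices. -/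
@[ext]
structure LevelData (ρ : T → TreeAut d) (M : ℕ) where
  state : T → Fin M → restrictions ρ
  acts : T → Fin M → Fin M → Prop
  same : Fin M → Fin M → Prop

theorem finite_levelData [Finite T] {ρ : T → TreeAut d} (hρ : ∀ y, (ρ y).IsAutomaton) (M : ℕ) :
    Finite (LevelData ρ M) := by
  have : Finite (restrictions ρ) :=
    Set.finite_iUnion fun y => (hρ y).finite_range_restrict
  refine Finite.of_injective (fun D : LevelData ρ M => (D.state, D.acts, D.same)) ?_
  intro D D' h
  simp only [Prod.mk.injEq] at h
  exact LevelData.ext h.1 h.2.1 h.2.2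

/-- The data of a tuple of marked vertices. -/
def levelData (ρ : T → TreeAut d) {M : ℕ} (e : Fin M → List (Fin d)) : LevelData ρ M where
  state y i := ⟨(ρ y).restrict (e i), Set.mem_iUnion.2 ⟨y, e i, rfl⟩⟩
  acts y i j := ρ y (e i) = e j
  same i j := e i = e j

/-- Mark children of marked vertices: the parents and the last letters are given by `t`. -/
def extend {M : ℕ} (e : Fin M → List (Fin d)) (t : Fin M → Fin M × Fin d) :
    Fin M → List (Fin d) :=
  fun i => e (t i).1 ++ [(t i).2]

/-- The effect of `extend` on the data. -/
def LevelData.descend {ρ : T → TreeAut d} {M : ℕ} (D : LevelData ρ M)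
    (t : Fin M → Fin M × Fin d) : LevelData ρ M where
  state y i := ⟨(D.state y (t i).1).1.restrict [(t i).2],
    restrict_mem_restrictions (D.state y (t i).1).2 _⟩
  acts y i j := D.acts y (t i).1 (t j).1 ∧ (D.state y (t i).1).1 [(t i).2] = [(t j).2]
  same i j := D.same (t i).1 (t j).1 ∧ (t i).2 = (t j).2

theorem append_singleton_inj {p q : List (Fin d)} {a b : Fin d} :
    p ++ [a] = q ++ [b] ↔ p = q ∧ a = b := by
  rw [← List.concat_eq_append, ← List.concat_eq_append, List.concat_inj]

/-- This lets a finite automaton follow the data down the tree without remembering the vertices. -/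
theorem levelData_extend (ρ : T → TreeAut d) {M : ℕ} (e : Fin M → List (Fin d))
    (t : Fin M → Fin M × Fin d) :
    levelData ρ (extend e t) = (levelData ρ e).descend t := by
  ext y i j
  · simp only [levelData, LevelData.descend, extend, TreeAut.restrict_append]
  · simp only [levelData, LevelData.descend, extend, TreeAut.apply_append]
    constructor
    · exact fun h => List.append_inj' h (by rw [TreeAut.length_apply]; rfl)
    · rintro ⟨h₁, h₂⟩
      rw [h₁, h₂]
  · exact append_singleton_inj

/-! ### Nonterminals, tables and rules -/

/-- Nonterminals: `gap i j` stands for the words carrying the marked vertex `i` to `j`, and `child`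
for the words doing so with given children of marked vertices. -/
inductive NT (d M : ℕ) : Type
  | start : NT d M
  | dead : NT d M
  | gap (i j : Fin M) : NT d M
  | child (x y : Fin M × Fin d) : NT d M

instance (d M : ℕ) : Finite (NT d M) := by
  refine Finite.of_surjective
    (α := Bool ⊕ (Fin M × Fin M) ⊕ ((Fin M × Fin d) × (Fin M × Fin d)))
    (fun
      | .inl b => bif b then .start else .dead
      | .inr (.inl x) => .gap x.1 x.2
      | .inr (.inr x) => .child x.1 x.2) ?_
  rintro (_ | _ | ⟨i, j⟩ | ⟨x, y⟩)
  · exact ⟨.inl true, rfl⟩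
  · exact ⟨.inl false, rfl⟩
  · exact ⟨.inr (.inl (i, j)), rfl⟩
  · exact ⟨.inr (.inr (x, y)), rfl⟩

/-- Tables: rewriting within a level, and passing from a level to the one above it. -/
inductive TableName (ρ : T → TreeAut d) (M : ℕ) : Type
  | expand (D : LevelData ρ M) : TableName ρ M
  | ascend (t : Fin M → Fin M × Fin d) : TableName ρ M

theorem finite_tableName [Finite T] {ρ : T → TreeAut d} (hρ : ∀ y, (ρ y).IsAutomaton) (M : ℕ) :
    Finite (TableName ρ M) := by
  have := finite_levelData hρ M
  refine Finite.of_surjective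
    (α := LevelData ρ M ⊕ (Fin M → Fin M × Fin d)) (Sum.elim .expand .ascend) ?_
  rintro (D | t)
  · exact ⟨.inl D, rfl⟩
  · exact ⟨.inr t, rfl⟩

/-- The rules for rewriting within a level. -/
inductive ExpandRule {ρ : T → TreeAut d} {M : ℕ} (D : LevelData ρ M) :
    NT d M → List (Symbol T (NT d M)) → Prop
  | keep (X : NT d M) : ExpandRule D X [.nonterminal X]
  | start (i j : Fin M) (h : ¬ D.same i j) : ExpandRule D .start [.nonterminal (.gap i j)]
  | nil (i j : Fin M) (h : D.same i j) : ExpandRule D (.gap i j) []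
  | step (y : T) (i j j' : Fin M) (h : D.acts y j' j) (h1 : (D.state y j').1 = 1) :
      ExpandRule D (.gap i j) [.terminal y, .nonterminal (.gap i j')]
  | stay (i j : Fin M) (a : Fin d) :
      ExpandRule D (.child (i, a) (j, a)) [.nonterminal (.gap i j)]
  -- The cut of `CarriesTo.split`: the right factor acts first; once `y` has acted the last letter
  -- stays `b`, so the left factor is a `gap` between parents.
  | last (y : T) (i j r s : Fin M) (a b c : Fin d) (h : D.acts y r s)
      (hc : (D.state y r).1 [c] = [b]) (h1 : (D.state y r).1.restrict [c] = 1) :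
      ExpandRule D (.child (i, a) (j, b))
        [.nonterminal (.gap s j), .terminal y, .nonterminal (.child (i, a) (r, c))]

/-- The rules for passing to the level above. -/
inductive AscendRule (T : Type) {M : ℕ} (t : Fin M → Fin M × Fin d) :
    NT d M → List (Symbol T (NT d M)) → Prop
  | start : AscendRule T t .start [.nonterminal .start]
  | dead : AscendRule T t .dead [.nonterminal .dead]
  | gap (i j : Fin M) : AscendRule T t (.gap i j) [.nonterminal (.child (t i) (t j))]
  -- A `child` must be resolved before the next ascent, because `dead` can never be removed.
  | child (x y : Fin M × Fin d) : AscendRule T t (.child x y) [.nonterminal .dead]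

theorem finite_rules {N : Type} [Finite T] [Finite N] (R : N → List (Symbol T N) → Prop) (n : ℕ)
    (hR : ∀ X u, R X u → u.length ≤ n) : {x : N × List (Symbol T N) | R x.1 x.2}.Finite := by
  have : Finite (Symbol T N) := by
    refine Finite.of_surjective (α := T ⊕ N) (Sum.elim .terminal .nonterminal) ?_
    rintro (a | X)
    · exact ⟨.inl a, rfl⟩
    · exact ⟨.inr X, rfl⟩
  exact (Set.finite_univ.prod (List.finite_length_le (Symbol T N) n)).subset
    fun x hx => ⟨Set.mem_univ _, hR _ _ hx⟩

variable {ρ : T → TreeAut d} {M : ℕ}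

/-- The tables of the grammar. -/
def table [Finite T] : TableName ρ M → ET0LTable T (NT d M)
  | .expand D =>
    { rules := {x | ExpandRule D x.1 x.2}
      finite_rules := finite_rules _ 3 fun X u h => by cases h <;> simp
      total := fun X => ⟨_, .keep X⟩ }
  | .ascend t =>
    { rules := {x | AscendRule T t x.1 x.2}
      finite_rules := finite_rules _ 1 fun X u h => by cases h <;> simp
      total := fun X => match X with
        | .start => ⟨_, .start⟩
        | .dead => ⟨_, .dead⟩
        | .gap i j => ⟨_, .gap i j⟩
        | .child x y => ⟨_, .child x y⟩ }

/-! ### Validity of table sequences as regular control -/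

/-- The marked vertices described by a sequence of tables, the last of which is for the root. -/
def points : List (TableName ρ M) → Fin M → List (Fin d)
  | [] => fun _ => []
  | .expand _ :: v => points v
  | .ascend t :: v => extend (points v) t

/-- A sequence of tables is valid if each `expand` has the data of the marked vertices. -/
def IsValid : List (TableName ρ M) → Prop
  | [] => True
  | .expand D :: v => D = levelData ρ (points v) ∧ IsValid v
  | .ascend _ :: v => IsValid v

open Classical in
/-- A deterministic automaton that checks validity, reading from the root downwards. -/
noncomputable def validityDFA (ρ : T → TreeAut d) (M : ℕ) :
    DFA (TableName ρ M) (Option (LevelData ρ M)) where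
  step s x := match s, x with
    | some D, .expand D' => if D' = D then some D else none
    | some D, .ascend t => some (D.descend t)
    | none, _ => none
  start := some (levelData ρ fun _ => [])
  accept := {s | s.isSome}

-- Derivations end at the root, so the reversed sequence visits levels from the root down. The state
-- is the data of the current level; `none` records a mismatch.
open Classical in
theorem validityDFA_eval_reverse (v : List (TableName ρ M)) :
    (validityDFA ρ M).eval v.reverse =
      if IsValid v then some (levelData ρ (points v)) else none := by
  induction v with
  | nil => simp [IsValid, points, validityDFA]
  | cons x v ih =>
    rw [List.reverse_cons, DFA.eval_append_singleton, ih]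
    by_cases hv : IsValid v
    · cases x with
      | expand D => by_cases hD : D = levelData ρ (points v) <;>
          simp [validityDFA, IsValid, points, hv, hD]
      | ascend t => simp [validityDFA, IsValid, points, hv, levelData_extend]
    · cases x <;> simp [validityDFA, IsValid, hv]

theorem isRegular_setOf_isValid [Finite T] (hρ : ∀ y, (ρ y).IsAutomaton) :
    Language.IsRegular ({v | IsValid v} : Language (TableName ρ M)) := by
  classical
  have := finite_levelData hρ M
  have := Fintype.ofFinite (LevelData ρ M)
  refine Language.IsRegular.of_reverse ⟨_, inferInstance, validityDFA ρ M, ?_⟩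
  ext v
  obtain ⟨v, rfl⟩ : ∃ u : List (TableName ρ M), v = u.reverse := ⟨v.reverse, by simp⟩
  refine Iff.trans ?_ Language.mem_reverse.symm
  rw [DFA.mem_accepts, validityDFA_eval_reverse, List.reverse_reverse]
  change _ ↔ IsValid v
  split_ifs with h <;> simp [validityDFA, h]

/-- The grammar generating the words that move some vertex. -/
def grammar [Finite T] (hρ : ∀ y, (ρ y).IsAutomaton) (M : ℕ) : ET0LGrammar T where
  NT := NT d M
  TableName := TableName ρ M
  finite_tableName := finite_tableName hρ M
  table := table
  control := {v | IsValid v}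
  control_regular := isRegular_setOf_isValid hρ
  start := .start

/-! ### Soundness -/

/-- The words that a nonterminal may generate when the marked vertices are `e`. -/
def meaning (ρ : T → TreeAut d) (e : Fin M → List (Fin d)) : NT d M → Language T
  | .start => {w | (w.map ρ).prod ≠ 1}
  | .dead => 0
  | .gap i j => {w | CarriesTo ρ w (e i) (e j)}
  | .child x y => {w | CarriesTo ρ w (e x.1 ++ [x.2]) (e y.1 ++ [y.2])}

open ET0LTable in
theorem expandRule_sound (e : Fin M → List (Fin d)) {X : NT d M} {u : List (Symbol T (NT d M))}
    (h : ExpandRule (levelData ρ e) X u) :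
    ∀ w ∈ sentenceLanguage (meaning ρ e) u, w ∈ meaning ρ e X := by
  intro w hw
  cases h with
  | keep => exact mem_sentenceLanguage_nonterminal.1 hw
  | start i j h =>
    have hc : CarriesTo ρ w (e i) (e j) :=
      (mem_sentenceLanguage_nonterminal (L := meaning ρ e) (X := .gap i j)).1 hw
    intro h1
    have h2 := hc.prod_apply
    rw [h1] at h2
    exact h h2
  | nil i j h =>
    obtain rfl := mem_sentenceLanguage_nil.1 hw
    exact h
  | step y i j j' h h1 =>
    obtain ⟨w, hw', rfl⟩ := mem_sentenceLanguage_terminal_cons.1 hw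
    have hc : CarriesTo ρ w (e i) (e j') :=
      (mem_sentenceLanguage_nonterminal (L := meaning ρ e) (X := .gap i j')).1 hw'
    exact ⟨e j', hc, h, h1⟩
  | stay i j a =>
    have hc : CarriesTo ρ w (e i) (e j) :=
      (mem_sentenceLanguage_nonterminal (L := meaning ρ e) (X := .gap i j)).1 hw
    exact hc.append_right [a]
  | last y i j r s a b c h hc h1 =>
    obtain ⟨w₁, hw₁, w₂, hw₂, rfl⟩ := mem_sentenceLanguage_nonterminal_cons.1 hw
    obtain ⟨w₂, hw₂', rfl⟩ := mem_sentenceLanguage_terminal_cons.1 hw₂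
    have h₁ : CarriesTo ρ w₁ (e s) (e j) := hw₁
    have h₂ : CarriesTo ρ w₂ (e i ++ [a]) (e r ++ [c]) :=
      (mem_sentenceLanguage_nonterminal (L := meaning ρ e) (X := .child (i, a) (r, c))).1 hw₂'
    refine (h₁.append_right [b]).append ⟨e r ++ [c], h₂, ?_, ?_⟩
    · rw [TreeAut.apply_append]
      exact congrArg₂ (· ++ ·) h hc
    · rw [TreeAut.restrict_append]
      exact h1

-- By definition of `extend`, `gap i j` below means the same as `child (t i) (t j)` above.
open ET0LTable in
theorem ascendRule_sound (e : Fin M → List (Fin d)) (t : Fin M → Fin M × Fin d) {X : NT d M}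
    {u : List (Symbol T (NT d M))} (h : AscendRule T t X u) :
    ∀ w ∈ sentenceLanguage (meaning ρ e) u, w ∈ meaning ρ (extend e t) X := by
  intro w hw
  cases h with
  | start => exact mem_sentenceLanguage_nonterminal.1 hw
  | dead => exact mem_sentenceLanguage_nonterminal.1 hw
  | gap i j => exact mem_sentenceLanguage_nonterminal.1 hw
  | child x y => exact (Language.notMem_zero w (mem_sentenceLanguage_nonterminal.1 hw)).elim

/-- Each sentential form is interpreted by the marked vertices of the tables still to be applied;
validity makes the side conditions of the rules true facts about these vertices. -/
theorem mem_meaning_of_derives [Finite T] (hρ : ∀ y, (ρ y).IsAutomaton)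
    {v : List (TableName ρ M)} (hv : IsValid v) {u : List (Symbol T (NT d M))} {w : List T}
    (h : (grammar hρ M).Generates v u w) :
    w ∈ ET0LTable.sentenceLanguage (meaning ρ (points v)) u := by
  induction v generalizing u with
  | nil =>
    obtain rfl : u = w.map Symbol.terminal := h
    exact ET0LTable.mem_sentenceLanguage_map_terminal _ w
  | cons x v ih =>
    obtain ⟨u', hs, hu'⟩ := h
    cases x with
    | expand D =>
      obtain ⟨rfl, hv⟩ := hv
      exact ET0LTable.Step.sentenceLanguage_subset (τ := table (.expand (levelData ρ (points v))))
        (fun X u (hX : ExpandRule _ X u) => expandRule_sound (points v) hX)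
        hs w (ih hv hu')
    | ascend t =>
      exact ET0LTable.Step.sentenceLanguage_subset (τ := table (ρ := ρ) (.ascend t))
        (fun X u (hX : AscendRule T t X u) => ascendRule_sound (points v) t hX)
        hs w (ih hv hu')

/-! ### Completeness -/

open Filter

theorem generates_expand [Finite T] {hρ : ∀ y, (ρ y).IsAutomaton} {D : LevelData ρ M} {X : NT d M}
    {u : List (Symbol T (NT d M))} {v : List (TableName ρ M)} {w : List T}
    (hX : ExpandRule D X u) (h : (grammar hρ M).Generates v u w) :
    (grammar hρ M).Generates (.expand D :: v) [.nonterminal X] w :=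
  ET0LGrammar.Generates.of_rule (g := grammar hρ M) (t := .expand D) hX h

/-- All occurrences are rewritten in parallel by the same tables, so a nonterminal must be able to
idle while others are expanded. -/
theorem generates_replicate_expand [Finite T] {hρ : ∀ y, (ρ y).IsAutomaton} {X : NT d M}
    {v : List (TableName ρ M)} {w : List T} (h : (grammar hρ M).Generates v [.nonterminal X] w)
    (D : LevelData ρ M) (r : ℕ) :
    (grammar hρ M).Generates (List.replicate r (.expand D) ++ v) [.nonterminal X] w :=
  ET0LGrammar.Generates.replicate (g := grammar hρ M) (t := .expand D) (ExpandRule.keep X) h r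

/-- Each cut costs one `expand`, and both factors must then be generated by the same tables; "for
all large `m`" makes their requirements compatible. The count `r` is separate from `m` because the
induction consumes tables of this level only. -/
theorem eventually_generates_child [Finite T] (hρ : ∀ y, (ρ y).IsAutomaton)
    {e : Fin M → List (Fin d)} {k : ℕ} (he : ∀ i, (e i).length = k)
    (hcover : ∀ y r, r.length = k → (ρ y).restrict r ≠ 1 →
      r ∈ Set.range e ∧ ρ y r ∈ Set.range e)
    {v : ℕ → List (TableName ρ M)}
    (hv : ∀ i j w, CarriesTo ρ w (e i) (e j) →
      ∀ᶠ m in atTop, (grammar hρ M).Generates (v m) [.nonterminal (.gap i j)] w)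
    (n : ℕ) (w : List T) (hw : w.length ≤ n) (i j : Fin M) (a b : Fin d)
    (h : CarriesTo ρ w (e i ++ [a]) (e j ++ [b])) :
    ∃ r₀, ∀ᶠ m in atTop, ∀ r ≥ r₀,
      (grammar hρ M).Generates (List.replicate r (.expand (levelData ρ e)) ++ v m)
        [.nonterminal (.child (i, a) (j, b))] w := by
  induction n generalizing w j b with
  | zero =>
    obtain rfl : w = [] := List.length_eq_zero_iff.1 (Nat.le_zero.1 hw)
    obtain ⟨hij, rfl⟩ := append_singleton_inj.1 h
    refine ⟨1, (hv i j [] hij).mono fun m hm r hr => ?_⟩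
    obtain ⟨r, rfl⟩ := Nat.exists_eq_add_of_le' hr
    exact generates_expand (ExpandRule.stay i j a) (generates_replicate_expand hm _ r)
  | succ n ih =>
    rcases h.split with ⟨hij, rfl⟩ | ⟨w₁, y, w₂, p, c, rfl, hp, h₂, hc, h1, h₁⟩
    · refine ⟨1, (hv i j w hij).mono fun m hm r hr => ?_⟩
      obtain ⟨r, rfl⟩ := Nat.exists_eq_add_of_le' hr
      exact generates_expand (ExpandRule.stay i j a) (generates_replicate_expand hm _ r)
    · have hlen : p.length = k := by
        have := h₂.length_eq
        rw [List.length_append, List.length_append, he] at this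
        simpa using this.symm
      obtain ⟨⟨p, rfl⟩, ⟨s, hs⟩⟩ := hcover y p hlen hp
      rw [← hs] at h₁
      obtain ⟨r₀, hr₀⟩ := ih w₂ (by simp at hw; omega) p c h₂
      refine ⟨r₀ + 1, ?_⟩
      filter_upwards [hv s j w₁ h₁, hr₀] with m hm₁ hm₂ r hr
      obtain ⟨r, rfl⟩ := Nat.exists_eq_add_of_le' (Nat.le_of_add_left_le hr)
      rw [TreeAut.restrict_append] at h1
      refine generates_expand (ExpandRule.last y i j p s a b c hs.symm hc h1) ?_
      exact (generates_replicate_expand hm₁ _ r).append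
        ((hm₂ r (by omega)).terminal_cons y)

/-- All indices denote the root, so the word is written letter by letter: one table per letter and
one to erase the nonterminal. -/
theorem generates_gap_root [Finite T] (hρ : ∀ y, (ρ y).IsAutomaton) (w : List T)
    (hw : CarriesTo ρ w [] []) (i j : Fin M) (r : ℕ) (hr : w.length < r) :
    (grammar hρ M).Generates (List.replicate r (.expand (levelData ρ fun _ => [])))
      [.nonterminal (.gap i j)] w := by
  induction w generalizing r with
  | nil =>
    obtain ⟨r, rfl⟩ := Nat.exists_eq_add_of_le' (Nat.one_le_of_lt hr)
    exact generates_expand (ExpandRule.nil i j rfl) (ET0LGrammar.generates_map_terminal _ [])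
  | cons y w ih =>
    obtain ⟨s, hs, -, h1⟩ := hw
    obtain rfl : s = [] := by simpa using hs.length_eq.symm
    obtain ⟨r, rfl⟩ := Nat.exists_eq_add_of_le' (Nat.one_le_of_lt hr)
    refine generates_expand (ExpandRule.step y i j j (TreeAut.apply_nil _) h1) ?_
    exact (ih hs r (by simpa using hr)).terminal_cons y

/-- Repetitions are allowed: `M` is fixed while the number of marked vertices varies with the level.
-/
theorem exists_range_eq {α : Type*} {S : Set α} (hne : S.Nonempty) (hS : S.encard ≤ M) :
    ∃ e : Fin M → α, Set.range e = S := by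
  have hfin : S.Finite := Set.finite_of_encard_le_coe hS
  have := hfin.to_subtype
  have := hne.to_subtype
  have hcard : Nat.card S ≤ M := by
    rw [Nat.card_coe_set_eq]
    rw [← hfin.cast_ncard_eq] at hS
    exact_mod_cast hS
  let f : S ↪ Fin M := (Finite.equivFin S).toEmbedding.trans (Fin.castLEEmb hcard)
  refine ⟨fun i => (Function.invFun f i : S), ?_⟩
  ext x
  constructor
  · rintro ⟨i, rfl⟩
    exact Subtype.coe_prop _
  · intro hx
    exact ⟨f ⟨x, hx⟩, congrArg Subtype.val (Function.leftInverse_invFun f.injective ⟨x, hx⟩)⟩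

/-- If the sets `P k` contain the vertices with nontrivial restrictions and their images, then the
grammar can mark the vertices of each `P k` and generate all words carrying one to another. -/
theorem exists_tables [Finite T] (hρ : ∀ y, (ρ y).IsAutomaton) {P : ℕ → Set (List (Fin d))}
    (hcard : ∀ k, (P k).encard ≤ M) (hne : ∀ k, (P k).Nonempty)
    (hlen : ∀ k, ∀ p ∈ P k, p.length = k) (hpre : ∀ k p a, p ++ [a] ∈ P (k + 1) → p ∈ P k)
    (hcover : ∀ k y r, r.length = k → (ρ y).restrict r ≠ 1 → r ∈ P k ∧ ρ y r ∈ P k) (k : ℕ) :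
    ∃ e : Fin M → List (Fin d), Set.range e = P k ∧ ∃ v : ℕ → List (TableName ρ M),
      (∀ m, IsValid (v m) ∧ points (v m) = e) ∧
      ∀ i j w, CarriesTo ρ w (e i) (e j) →
        ∀ᶠ m in atTop, (grammar hρ M).Generates (v m) [.nonterminal (.gap i j)] w := by
  have hrep : ∀ (v : List (TableName ρ M)) (r : ℕ), IsValid v →
      IsValid (List.replicate r (.expand (levelData ρ (points v))) ++ v) ∧
      points (List.replicate r (.expand (levelData ρ (points v))) ++ v) = points v := by
    intro v r hv
    induction r with
    | zero => exact ⟨hv, rfl⟩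
    | succ r ih =>
      refine ⟨⟨?_, ih.1⟩, ih.2⟩
      exact congrArg (levelData ρ) ih.2.symm
  induction k with
  | zero =>
    obtain ⟨e, he⟩ := exists_range_eq (hne 0) (hcard 0)
    obtain rfl : e = fun _ => [] := funext fun i =>
      List.length_eq_zero_iff.1 (hlen 0 _ (he ▸ Set.mem_range_self i))
    refine ⟨_, he, fun m => List.replicate m (.expand (levelData ρ fun _ => [])), fun m => ?_,
      fun i j w hw => ?_⟩
    · simpa [points] using hrep [] m trivial
    · exact (eventually_gt_atTop w.length).mono fun m hm => generates_gap_root hρ w hw i j m hm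
  | succ k ih =>
    obtain ⟨e, he, v, hv, hgap⟩ := ih
    obtain ⟨e', he'⟩ := exists_range_eq (hne (k + 1)) (hcard (k + 1))
    have hpar : ∀ i, ∃ x : Fin M × Fin d, e' i = e x.1 ++ [x.2] := by
      intro i
      have hi : e' i ∈ P (k + 1) := he' ▸ Set.mem_range_self i
      have hnil : e' i ≠ [] := by
        intro h
        simpa [h] using hlen _ _ hi
      obtain ⟨p, a, hpa⟩ : ∃ p a, e' i = p ++ [a] :=
        ⟨_, _, (List.dropLast_append_getLast hnil).symm⟩
      rw [hpa] at hi
      obtain ⟨x, rfl⟩ : p ∈ Set.range e := he ▸ hpre k p a hi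
      exact ⟨(x, a), hpa⟩
    choose t ht using hpar
    obtain rfl : e' = extend e t := funext ht
    -- The same `m` counts the `expand` tables on every level.
    refine ⟨_, he', fun m => .ascend t :: (List.replicate m (.expand (levelData ρ e)) ++ v m),
      fun m => ?_, fun i j w hw => ?_⟩
    · have := hrep (v m) m (hv m).1
      rw [(hv m).2] at this
      exact ⟨this.1, congrArg (extend · t) this.2⟩
    · obtain ⟨r₀, hr₀⟩ := eventually_generates_child hρ
        (fun i => hlen k _ (he ▸ Set.mem_range_self i)) (fun y r hr h => he ▸ hcover k y r hr h)
        hgap w.length w le_rfl _ _ _ _ hw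
      filter_upwards [hr₀, eventually_ge_atTop r₀] with m hm hm'
      exact ET0LGrammar.Generates.of_rule (g := grammar hρ M) (t := .ascend t) (AscendRule.gap i j)
        (hm m hm')

/-! ### Choice of the marked vertices and conclusion -/

/-- The words in finitely many bounded automaton automorphisms that represent nontrivial
automorphisms form an ET0L language. -/
theorem isET0L_setOf_prod_ne_one (hd : 2 ≤ d) [Finite T] (hρ : ∀ y, (ρ y).IsAutomaton)
    (hb : ∀ y, (ρ y).IsBounded) : IsET0L ({w | (w.map ρ).prod ≠ 1} : Language T) := by
  have := Fintype.ofFinite T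
  choose N hN using hb
  -- Two rays, the vertices with nontrivial restrictions, and their images.
  set M : ℕ := 2 + ((∑ y, N y) + ∑ y, N y) with hM
  refine ⟨grammar hρ M, ?_⟩
  ext w
  constructor
  · rintro ⟨v, hv, h⟩
    exact ET0LTable.mem_sentenceLanguage_nonterminal.1 (mem_meaning_of_derives hρ hv h)
  · intro hw
    obtain ⟨p, q, hpq, h⟩ := (prod_ne_one_iff_exists_carriesTo hd (fun y => ⟨N y, hN y⟩) w).1 hw
    -- The prefix of length `k`, padded with the letter `0` beyond the end of the word, so that
    -- every level has a marked vertex.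
    let ray : List (Fin d) → ℕ → List (Fin d) := fun p k =>
      (List.range k).map fun i => p.getD i ⟨0, by omega⟩
    have ray_length : ∀ p, ray p p.length = p := fun p =>
      List.ext_getElem (by simp [ray]) fun i h1 h2 => by simp [ray, h2]
    let W : T → ℕ → Set (List (Fin d)) := fun y k => {r | r.length = k ∧ (ρ y).restrict r ≠ 1}
    let P : ℕ → Set (List (Fin d)) := fun k =>
      {ray p k, ray q k} ∪ ((⋃ y, W y k) ∪ ⋃ y, ρ y '' W y k)
    have hWpre : ∀ y k r a, r ++ [a] ∈ W y (k + 1) → r ∈ W y k := by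
      rintro y k r a ⟨h1, h2⟩
      exact ⟨by simpa using h1, fun h3 => h2 (TreeAut.restrict_append_eq_one h3 _)⟩
    have hraypre : ∀ p k r a, r ++ [a] = ray p (k + 1) → r = ray p k := by
      intro p k r a h
      simp only [ray, List.range_succ, List.map_append, List.map_cons, List.map_nil] at h
      exact (append_singleton_inj.1 h).1
    have hcard : ∀ k, (P k).encard ≤ M := by
      intro k
      have hW : ∀ y, (W y k).encard ≤ N y := fun y => hN y k
      have hsum : ∀ V : T → Set (List (Fin d)), (∀ y, (V y).encard ≤ N y) →
          (⋃ y, V y).encard ≤ (∑ y, N y : ℕ) := fun V hV => by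
        rw [Nat.cast_sum]
        exact (Set.encard_iUnion_le_of_fintype V).trans (Finset.sum_le_sum fun y _ => hV y)
      have hpair : ∀ r s : List (Fin d), ({r, s} : Set (List (Fin d))).encard ≤ (2 : ℕ) :=
        fun r s => (Set.encard_insert_le _ _).trans (by rw [Set.encard_singleton]; norm_num)
      rw [hM, Nat.cast_add, Nat.cast_add]
      refine (Set.encard_union_le _ _).trans (add_le_add (hpair _ _)
        ((Set.encard_union_le _ _).trans (add_le_add (hsum _ hW) (hsum _ fun y => ?_))))
      exact (Set.encard_image_le _ _).trans (hW y)
    have hlen : ∀ k, ∀ r ∈ P k, r.length = k := by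
      intro k r hr
      rcases hr with (rfl | rfl) | hr | hr
      · simp [ray]
      · simp [ray]
      · obtain ⟨y, hy⟩ := Set.mem_iUnion.1 hr
        exact hy.1
      · obtain ⟨y, s, hs, rfl⟩ := Set.mem_iUnion.1 hr
        rw [TreeAut.length_apply]
        exact hs.1
    have hpre : ∀ k r a, r ++ [a] ∈ P (k + 1) → r ∈ P k := by
      intro k r a hr
      rcases hr with (hr | hr) | hr | hr
      · exact Or.inl (Or.inl (hraypre _ _ _ _ hr))
      · exact Or.inl (Or.inr (hraypre _ _ _ _ hr))
      · obtain ⟨y, hy⟩ := Set.mem_iUnion.1 hr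
        exact Or.inr (Or.inl (Set.mem_iUnion.2 ⟨y, hWpre y k r a hy⟩))
      · obtain ⟨y, s, hs, hsr⟩ := Set.mem_iUnion.1 hr
        have hne : s ≠ [] := by
          rintro rfl
          simpa using hs.1
        obtain ⟨s, b, rfl⟩ : ∃ s' b, s = s' ++ [b] :=
          ⟨_, _, (List.dropLast_append_getLast hne).symm⟩
        rw [TreeAut.apply_append] at hsr
        have := (List.append_inj' hsr (by rw [TreeAut.length_apply]; rfl)).1
        exact Or.inr (Or.inr (Set.mem_iUnion.2 ⟨y, s, hWpre y k s b hs, this⟩))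
    have hcover : ∀ k y r, r.length = k → (ρ y).restrict r ≠ 1 → r ∈ P k ∧ ρ y r ∈ P k := by
      intro k y r hr h1
      exact ⟨Or.inr (Or.inl (Set.mem_iUnion.2 ⟨y, hr, h1⟩)),
        Or.inr (Or.inr (Set.mem_iUnion.2 ⟨y, r, ⟨hr, h1⟩, rfl⟩))⟩
    obtain ⟨e, he, v, hv, hgap⟩ := exists_tables (M := M) hρ hcard
      (fun k => ⟨ray p k, by simp [P]⟩) hlen hpre hcover p.length
    obtain ⟨i, hi⟩ : p ∈ Set.range e := by
      rw [he]
      exact Or.inl (Or.inl (ray_length p).symm)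
    obtain ⟨j, hj⟩ : q ∈ Set.range e := by
      rw [he, h.length_eq]
      exact Or.inl (Or.inr (ray_length q).symm)
    obtain ⟨m, hm⟩ := (hgap i j w (by rwa [hi, hj])).exists
    -- One extra `expand` turns the start symbol into `gap i j`.
    refine ⟨.expand (levelData ρ e) :: v m, ⟨by rw [(hv m).2], (hv m).1⟩, ?_⟩
    refine generates_expand (ExpandRule.start i j ?_) hm
    change ¬ e i = e j
    rwa [hi, hj]

end OrbitGrammar

theorem theorem4p1 (d : ℕ) (hd : 2 ≤ d) (G : Subgroup (TreeAut d))
    (hG : IsBoundedAutomataGroup G) (hfg : Group.FG G) : IsCoET0L G := by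
  refine ⟨hfg, fun X hX _ => ?_⟩
  have : Finite ↥(X ∪ X⁻¹) := (hX.union hX.inv).to_subtype
  let ρ : ↥(X ∪ X⁻¹) → TreeAut d := fun x => ((x : G) : TreeAut d)
  have h := OrbitGrammar.isET0L_setOf_prod_ne_one (ρ := ρ) hd (fun x => (hG _ (x : G).2).1)
    fun x => (hG _ (x : G).2).2
  have hX : coWordProblem X = ({w | (w.map ρ).prod ≠ 1} : Language ↥(X ∪ X⁻¹)) := by
    ext w
    have hw : w ∈ coWordProblem X ↔ (w.map fun x : ↥(X ∪ X⁻¹) => (x : G)).prod ≠ 1 := by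
      -- The coercion in `coWordProblem` unfolds to a `flatMap` of singletons.
      change (List.map id (List.flatMap (fun a : ↥(X ∪ X⁻¹) => [(a : G)]) w)).prod ≠ 1 ↔ _
      rw [List.map_id, List.map_eq_flatMap]
    refine hw.trans ?_
    change _ ↔ (w.map ρ).prod ≠ 1
    have hprod : (w.map ρ).prod = (((w.map fun x : ↥(X ∪ X⁻¹) => (x : G)).prod : G) : TreeAut d) := by
      rw [SubmonoidClass.coe_list_prod, List.map_map]
      rfl
    rw [hprod, Ne, Ne, OneMemClass.coe_eq_one]
  rw [hX]
  exact h
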